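/- A distinct covering system is a finite set $\mathcal C$ of congruences $x\equiv r_i \pmod{n_i}$, $i=1,\dots,k$, whose moduli $n_i$ are distinct integers greater than $1$, such that every integer satisfies at least one of the congruences. For positive integers $a\ge b\ge c$, call $\mathcal C$ a covering of type $(a,b,c)$ if it is a distinct covering system with least modulus equal to $5$ and with the least common multiple of its moduli equal to $2^a3^b5^c$. Let $a\ge b\ge c\ge 1$ be integers, and suppose that there is a covering of type $(a,b,c)$. Then: (i) $b\ge 2$. (ii) If $a=3$, then $b\ge 3$ and $c\ge 2$. (iv) If $a=4$ and $b=2$, then $c\ge 2$. Moreover: (iii) There exists a covering of type $(3,3,2)$ none of whose moduli is a multiple of $675$. (v) There exists a covering of type $(4,2,2)$ that does not use any of the moduli $25$, $100$, $300$, $900$. (vi) There exists a covering of type $(4,3,1)$ that does not use the modulus $180$. (vii) There exists a covering of type $(5,2,1)$. Consequently, for integers $a\ge b\ge c\ge 1$, a covering of type $(a,b,c)$ exists if and only if one of the following holds: $a=b=3$ and $c\ge 2$; or $a=4$, $b\ge 2$, and ($b\ge 3$ or $c\ge 2$); or $a\ge 5$ and $b\ge 2$. -/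

import Mathlib

/-- A distinct covering system, given as a finite set of congruences. A pair `(n, r)` stands for the
congruence `x ≡ r (mod n)`. All moduli are greater than `1`, two different congruences have
different moduli, and every integer satisfies at least one of the congruences. -/
def IsDistinctCovering (C : Finset (ℕ × ℤ)) : Prop :=
  (∀ p ∈ C, 1 < p.1) ∧
  (∀ p ∈ C, ∀ q ∈ C, p.1 = q.1 → p = q) ∧
  (∀ x : ℤ, ∃ p ∈ C, x ≡ p.2 [ZMOD (p.1 : ℤ)])

/-- `n` is one of the moduli of the congruences in `C`. -/
def IsModulus (C : Finset (ℕ × ℤ)) (n : ℕ) : Prop := ∃ p ∈ C, p.1 = n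

/-- `C` is a distinct covering system whose least modulus is `m` and for which the least common
multiple of all the moduli is `L`. -/
def IsDistinctCoveringWith (m L : ℕ) (C : Finset (ℕ × ℤ)) : Prop :=
  IsDistinctCovering C ∧ IsLeast {n : ℕ | IsModulus C n} m ∧ C.lcm Prod.fst = L

/-! If the lcm of a covering with least modulus 5 divides L, then `range L` is covered by one
residue class for each divisor of L that is at least 5; divisors that are not moduli get arbitrary
classes (`IsDistinctCoveringWith.coverable`). Nonexistence therefore only has to be shown for the
types (a,1,1) and for L = 720, 1080, 1800, that is, for the types (4,2,1), (3,3,1), (3,2,2) and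
everything dividing them.

Type (a,1,1) falls to a density count. Outside the class modulo 5, a modulus prime to 5 covers at
most 4/5 of its usual density. The moduli 5, 8·2^j, 6·2^j, 10·2^j, 15·2^j then contribute 1/5 + 1/5
+ 4/15 + 1/5 + 2/15 = 1 if j is unbounded, hence strictly less than 1 for finitely many j.

The other three values of L need a search (`refute`): branch on the class of the smallest remaining
modulus, and stop once the largest intersections of the uncovered set with classes of the remaining
moduli add up to less than its size. Branches are identified under exchanges of two sibling classes
modulo p^(j+1) inside one class modulo p^j, which permute the classes of every divisor of L. Sets
are stored as numbers in base 2^12, so that counting, intersecting and shifting become single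
arithmetic operations.

For existence, four explicit coverings are checked; a further congruence whose modulus is the new
lcm enlarges the lcm to any multiple (`IsDistinctCoveringWith.exists_of_dvd`). -/

section

open Finset

/-! ### The search procedure on packed sets -/

/-- Whether every residue class modulo `d` meets the packed set `U` in at most `t` points. -/
def capHolds (U d t : ℕ) : Bool :=
  Nat.beq (Nat.land (U % (2 ^ (12 * d) - 1) + (2047 - t) * ((2 ^ (12 * d) - 1) / 4095))
    (2048 * ((2 ^ (12 * d) - 1) / 4095))) 0

/-- The least `t` reached from a given cap downwards for which `capHolds` still succeeds. -/
def tightenCap (U d : ℕ) : ℕ → ℕ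
  | 0 => 0
  | t + 1 => bif capHolds U d t then tightenCap U d t else t + 1

/-- The sum of the caps, each the second component of its pair. -/
def capSum : List (ℕ × ℕ) → ℕ
  | [] => 0
  | c :: l => c.2 + capSum l

/-- Improve the caps of all moduli in a list of pairs (modulus, cap). -/
def tightenCaps (U : ℕ) : List (ℕ × ℕ) → List (ℕ × ℕ)
  | [] => []
  | c :: l => (c.1, tightenCap U c.1 c.2) :: tightenCaps U l

/-- The packed residue class of `r` modulo `d` in `range L`. -/
def classMask (L d r : ℕ) : ℕ := ((2 ^ (12 * L) - 1) / (2 ^ (12 * d) - 1)) * 2 ^ (12 * r)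

/-- The exchange of the classes of `u` and `v` modulo `q` by a shift by `s`. -/
structure Swap where
  q : ℕ
  u : ℕ
  v : ℕ
  s : ℕ

/-- The action of a swap on `range L`. -/
def Swap.map (L : ℕ) (w : Swap) (x : ℕ) : ℕ :=
  bif Nat.beq (x % w.q) w.u then (x + w.s) % L
  else bif Nat.beq (x % w.q) w.v then (x + (L - w.s)) % L else x

/-- Whether the packed set `U` is invariant under a swap. -/
def Swap.invariant (L U : ℕ) (w : Swap) : Bool :=
  Nat.beq ((Nat.land U (classMask L w.q w.u) * 2 ^ (12 * w.s)) % (2 ^ (12 * L) - 1))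
    (Nat.land U (classMask L w.q w.v))

/-- The swaps that act on the residues modulo `d` and preserve `U`. -/
def invariantSwaps (L U d : ℕ) : List Swap → List Swap
  | [] => []
  | w :: l => bif Nat.beq (d % w.q) 0 && w.invariant L U then w :: invariantSwaps L U d l
      else invariantSwaps L U d l

/-- Apply in turn each swap that moves the current residue from `u` to `v`. -/
def normalizeResidue (L : ℕ) : List Swap → ℕ → ℕ
  | [], r => r
  | w :: l, r => bif Nat.beq (r % w.q) w.u then normalizeResidue L l (w.map L r)
      else normalizeResidue L l r

/-- Membership in a list, as a Boolean the kernel evaluates quickly. -/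
def memList (r : ℕ) : List ℕ → Bool
  | [] => false
  | a :: l => Nat.beq r a || memList r l

/-- Normalized residues modulo `d` of the classes that meet `U`. -/
def representatives (L U d : ℕ) (W : List Swap) : ℕ → List ℕ
  | 0 => []
  | r + 1 =>
    bif Nat.beq (Nat.land U (classMask L d (normalizeResidue L W r % d))) 0 ||
        memList (normalizeResidue L W r % d) (representatives L U d W r)
    then representatives L U d W r
    else (normalizeResidue L W r % d) :: representatives L U d W r

/-- Whether all elements of a list satisfy `p`. -/
def allList (p : ℕ → Bool) : List ℕ → Bool
  | [] => true
  | a :: l => p a && allList p l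

/-- A search showing that the packed set `U` cannot be covered by one residue class for each of the
moduli in `caps`. A branch ends when the caps add up to less than the cardinality of `U`. -/
def refute (L : ℕ) (W : List Swap) : ℕ → List (ℕ × ℕ) → ℕ → Bool
  | 0, _, _ => false
  | f + 1, caps, U =>
    bif Nat.ble (capSum caps + 1) (U % 4095) then true
    else bif Nat.ble (capSum (tightenCaps U caps) + 1) (U % 4095) then true
    else match tightenCaps U caps with
      | [] => false
      | c :: rest =>
        bif Nat.ble 1 (representatives L U c.1 (invariantSwaps L U c.1 W) c.1).length then
          allList (fun r => refute L W f rest (U - Nat.land U (classMask L c.1 r)))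
            (representatives L U c.1 (invariantSwaps L U c.1 W) c.1)
        else false

/-! ### Arithmetic of packed sets -/

/-- A finite set of naturals packed into a number with one 12-bit digit for each natural. -/
def pack (S : Finset ℕ) : ℕ := ∑ x ∈ S, 2 ^ (12 * x)

theorem testBit_pack (S : Finset ℕ) (j : ℕ) : (pack S).testBit j = true ↔ ∃ x ∈ S, 12 * x = j := by
  have h : pack S = ∑ i ∈ S.image (fun x => 12 * x), 2 ^ i := by
    rw [Finset.sum_image]
    · rfl
    · intro x _ y _ h
      simpa using h
  rw [h, ← Nat.mem_bitIndices, ← List.mem_toFinset, toFinset_bitIndices_sum_two_pow]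
  simp

theorem land_pack (S T : Finset ℕ) : Nat.land (pack S) (pack T) = pack (S ∩ T) := by
  apply Nat.eq_of_testBit_eq
  intro j
  change (pack S &&& pack T).testBit j = _
  rw [Bool.eq_iff_iff, Nat.testBit_and, Bool.and_eq_true]
  simp only [testBit_pack, mem_inter]
  constructor
  · rintro ⟨⟨x, hx, rfl⟩, y, hy, h⟩
    obtain rfl : y = x := by omega
    exact ⟨y, ⟨hx, hy⟩, rfl⟩
  · rintro ⟨x, ⟨h1, h2⟩, rfl⟩
    exact ⟨⟨x, h1, rfl⟩, x, h2, rfl⟩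

theorem pack_injective : Function.Injective pack := by
  intro S T h
  ext x
  have h1 := testBit_pack S (12 * x)
  rw [h, testBit_pack] at h1
  simpa using h1.symm

theorem pack_sub_land (S T : Finset ℕ) : pack S - Nat.land (pack S) (pack T) = pack (S \ T) := by
  rw [land_pack]
  have h : pack (S \ T) + pack (S ∩ T) = pack S := by
    unfold pack
    rw [← sum_union (disjoint_sdiff_inter S T), sdiff_union_inter]
  omega

theorem pack_eq_zero {S : Finset ℕ} (h : pack S = 0) : S = ∅ :=
  pack_injective (by rw [h]; rfl)

/-- The number with all digits 4095 is 2^(12d) - 1 itself; digits at most 4094 stay strictly below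
it, so reduction modulo 2^(12d) - 1 leaves such a number unchanged. -/
theorem sum_pow_lt {d : ℕ} (hd : 0 < d) {c : ℕ → ℕ} (hc : ∀ r < d, c r ≤ 4094) :
    ∑ r ∈ range d, c r * 2 ^ (12 * r) < 2 ^ (12 * d) - 1 := by
  have h1 : ∑ r ∈ range d, c r * 2 ^ (12 * r) ≤ 4094 * ∑ r ∈ range d, (2 ^ 12) ^ r := by
    rw [mul_sum]
    apply sum_le_sum
    intro r hr
    rw [← pow_mul]
    exact Nat.mul_le_mul_right _ (hc r (by simpa using hr))
  have h2 := Nat.geomSum_eq (m := 2 ^ 12) (by norm_num) d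
  have h3 : 4095 ∣ 2 ^ (12 * d) - 1 := by
    have := Nat.sub_dvd_pow_sub_pow (2 ^ 12) 1 d
    simpa [pow_mul] using this
  rw [← pow_mul] at h2
  norm_num at h2
  have h4 : 0 < 2 ^ (12 * d) - 1 := by
    have : 2 ^ 1 ≤ 2 ^ (12 * d) := Nat.pow_le_pow_right (by norm_num) (by omega)
    omega
  simp only [show (2:ℕ) ^ 12 = 4096 by norm_num] at h1
  rw [h2] at h1
  omega

/-- The quotient is the packed set of multiples of d below d·n. It underlies `classMask`, and d = 1
gives the packed `range n`. -/
theorem geom_sum_pow (d n : ℕ) (hd : 0 < d) :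
    (2 ^ (12 * (d * n)) - 1) / (2 ^ (12 * d) - 1) = ∑ k ∈ range n, 2 ^ (12 * (d * k)) := by
  have h : 2 ≤ 2 ^ (12 * d) := by
    calc 2 = 2 ^ 1 := by norm_num
      _ ≤ _ := Nat.pow_le_pow_right (by norm_num) (by omega)
  have := Nat.geomSum_eq h n
  rw [← pow_mul, mul_assoc] at this
  rw [← this]
  apply sum_congr rfl
  intro k _
  rw [← pow_mul, mul_assoc]

/-- Modulo 2^(12d) - 1 the base power 2^(12d) is 1, so the element x lands on digit x % d, and each
digit counts one residue class. -/
theorem pack_modEq (S : Finset ℕ) {d : ℕ} (hd : 0 < d) :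
    pack S ≡ ∑ r ∈ range d, #{x ∈ S | x % d = r} * 2 ^ (12 * r) [MOD 2 ^ (12 * d) - 1] := by
  have h1 : pack S ≡ ∑ x ∈ S, 2 ^ (12 * (x % d)) [MOD 2 ^ (12 * d) - 1] := by
    unfold pack
    apply Nat.ModEq.sum
    intro x _
    have h : (2 ^ (12 * d)) ^ (x / d) ≡ 1 ^ (x / d) [MOD 2 ^ (12 * d) - 1] := by
      apply Nat.ModEq.pow
      exact ((Nat.modEq_iff_dvd' Nat.one_le_two_pow).2 dvd_rfl).symm
    have h2 : 2 ^ (12 * x) = (2 ^ (12 * d)) ^ (x / d) * 2 ^ (12 * (x % d)) := by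
      rw [← pow_mul, ← pow_add]
      congr 1
      conv_lhs => rw [← Nat.div_add_mod x d]
      ring
    rw [h2]
    simpa using h.mul_right (2 ^ (12 * (x % d)))
  refine h1.trans ?_
  rw [← sum_fiberwise_of_maps_to (s := S) (t := range d) (g := fun x => x % d)
    (fun x _ => by simpa using Nat.mod_lt x hd)]
  have : ∀ r ∈ range d, ∑ x ∈ S with x % d = r, 2 ^ (12 * (x % d))
      = #{x ∈ S | x % d = r} * 2 ^ (12 * r) := by
    intro r _
    rw [← smul_eq_mul, ← sum_const]
    apply sum_congr rfl
    intro x hx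
    rw [(mem_filter.1 hx).2]
  rw [sum_congr rfl this]

theorem pack_mod (S : Finset ℕ) {d : ℕ} (hd : 0 < d) (hS : #S ≤ 2047) :
    pack S % (2 ^ (12 * d) - 1) = ∑ r ∈ range d, #{x ∈ S | x % d = r} * 2 ^ (12 * r) := by
  rw [pack_modEq S hd, Nat.mod_eq_of_lt]
  apply sum_pow_lt hd
  intro r _
  have := card_filter_le S (fun x => x % d = r)
  omega

theorem pack_mod_eq_card (S : Finset ℕ) (hS : #S ≤ 2047) : pack S % 4095 = #S := by
  have := pack_mod S one_pos hS
  simpa [Nat.mod_one] using this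

theorem sum_digit (d : ℕ) : ∀ (r : ℕ) (a : ℕ → ℕ), (∀ i, a i < 2 ^ 12) → r < d →
    (∑ i ∈ range d, a i * 2 ^ (12 * i)) / 2 ^ (12 * r) % 2 ^ 12 = a r := by
  induction d with
  | zero => intro r a _ h; omega
  | succ d ih =>
    intro r a ha hr
    have h : ∑ i ∈ range (d + 1), a i * 2 ^ (12 * i)
        = 2 ^ 12 * (∑ i ∈ range d, a (i + 1) * 2 ^ (12 * i)) + a 0 := by
      rw [sum_range_succ', mul_sum]
      congr 1
      · apply sum_congr rfl
        intro i _
        ring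
      · simp
    rw [h]
    cases r with
    | zero =>
      have := ha 0
      rw [mul_zero, pow_zero, Nat.div_one, Nat.mul_add_mod, Nat.mod_eq_of_lt this]
    | succ r =>
      rw [show 12 * (r + 1) = 12 + 12 * r by ring, pow_add, ← Nat.div_div_eq_div_mul,
        Nat.mul_add_div (by norm_num), Nat.div_eq_of_lt (ha 0), add_zero]
      exact ih r (fun i => a (i + 1)) (fun i => ha _) (by omega)

theorem sum_testBit {d r : ℕ} {a : ℕ → ℕ} (ha : ∀ i, a i < 2 ^ 12) (hr : r < d) :
    (∑ i ∈ range d, a i * 2 ^ (12 * i)).testBit (12 * r + 11) = (a r).testBit 11 := by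
  conv_rhs => rw [← sum_digit d r a ha hr]
  rw [Nat.testBit_mod_two_pow, Nat.testBit_div_two_pow]
  simp [add_comm]

/-- Adding 2047 - t to a digit sets its top bit, of value 2048, exactly when a count above t was
stored there. Counts are at most 2047, so digits stay below 4096 and nothing carries. -/
theorem capHolds_sound {S : Finset ℕ} (hS : #S ≤ 2047) {d t : ℕ} (hd : 0 < d)
    (h : capHolds (pack S) d t = true) (r : ℕ) : #{x ∈ S | x % d = r} ≤ t := by
  by_cases hr : r < d
  swap
  · rw [filter_false_of_mem]
    · simp
    · intro x _ hx
      exact hr (hx ▸ Nat.mod_lt x hd)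
  have hc : ∀ i, #{x ∈ S | x % d = i} ≤ 2047 := fun i => (card_filter_le _ _).trans hS
  have hones : (2 ^ (12 * d) - 1) / 4095 = ∑ i ∈ range d, 2 ^ (12 * i) := by
    have := geom_sum_pow 1 d one_pos
    simpa using this
  have h := Nat.eq_of_beq_eq_true h
  rw [pack_mod S hd hS, hones, mul_sum, mul_sum, ← sum_add_distrib] at h
  simp only [← add_mul] at h
  by_contra hlt
  have hlt : t < #{x ∈ S | x % d = r} := not_le.1 hlt
  have hb := congrArg (fun n => n.testBit (12 * r + 11)) h
  change Nat.testBit (_ &&& _) _ = _ at hb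
  rw [Nat.testBit_and, sum_testBit (fun i => by have := hc i; omega) hr,
    sum_testBit (a := fun _ => 2048) (fun i => by norm_num) hr, Nat.zero_testBit] at hb
  have hr' := hc r
  rw [show Nat.testBit 2048 11 = true by decide, Bool.and_true, Nat.testBit_eq_decide_div_mod_eq,
    decide_eq_false_iff_not] at hb
  omega

theorem tightenCap_sound {S : Finset ℕ} (hS : #S ≤ 2047) {d : ℕ} (hd : 0 < d) (t : ℕ)
    (h : ∀ r, #{x ∈ S | x % d = r} ≤ t) (r : ℕ) :
    #{x ∈ S | x % d = r} ≤ tightenCap (pack S) d t := by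
  induction t with
  | zero => exact h r
  | succ t ih =>
    rw [tightenCap]
    cases hcap : capHolds (pack S) d t with
    | true => exact ih (capHolds_sound hS hd hcap)
    | false => exact h r

/-! ### Residue classes, coverability and swaps -/

/-- The residue class of `r` modulo `d` in `range L`. -/
def residueClass (L d r : ℕ) : Finset ℕ := {x ∈ range L | x % d = r}

theorem classMask_eq_pack {L d r : ℕ} (hdL : d ∣ L) (hr : r < d) :
    classMask L d r = pack (residueClass L d r) := by
  obtain ⟨n, rfl⟩ := hdL
  have h : residueClass (d * n) d r = (range n).image (fun k => d * k + r) := by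
    ext x
    simp only [residueClass, mem_filter, mem_range, mem_image]
    constructor
    · rintro ⟨h1, h2⟩
      exact ⟨x / d, Nat.div_lt_of_lt_mul h1, by rw [← h2]; exact Nat.div_add_mod x d⟩
    · rintro ⟨k, hk, rfl⟩
      refine ⟨?_, by rw [Nat.mul_add_mod, Nat.mod_eq_of_lt hr]⟩
      calc d * k + r < d * k + d := by omega
        _ = d * (k + 1) := by ring
        _ ≤ d * n := Nat.mul_le_mul_left _ hk
  rw [h, classMask, geom_sum_pow d n (by omega), pack, sum_image, sum_mul]
  · apply sum_congr rfl
    intro k _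
    ring
  · intro x _ y _ hxy
    have : d * x = d * y := by simpa using hxy
    exact Nat.eq_of_mul_eq_mul_left (by omega) this

/-- Some choice of one residue class for each modulus in `ds` covers `S`. -/
def Coverable (S : Finset ℕ) (ds : List ℕ) : Prop :=
  ∃ R : ℕ → ℕ, ∀ x ∈ S, ∃ d ∈ ds, x % d = R d % d

/-- The last clause makes the swap compatible with every modulus d: either the class modulo d
decides which shift applies, or the shift is invisible modulo d. -/
def Swap.Valid (L : ℕ) (ds : List ℕ) (w : Swap) : Prop :=
  w.q ∣ L ∧ w.u < w.q ∧ w.v < w.q ∧ w.u ≠ w.v ∧ (w.u + w.s) % w.q = w.v ∧ w.s ≤ L ∧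
    ∀ d ∈ ds, d ∣ L ∧ (w.q ∣ d ∨ d ∣ w.s)

instance (L : ℕ) (ds : List ℕ) (w : Swap) : Decidable (w.Valid L ds) := by
  unfold Swap.Valid
  infer_instance

theorem natBeq_of_ne {m n : ℕ} (h : m ≠ n) : Nat.beq m n = false :=
  Bool.eq_false_iff.2 fun hb => h (Nat.eq_of_beq_eq_true hb)

theorem Swap.map_of_eq_u {L : ℕ} {w : Swap} {x : ℕ} (h : x % w.q = w.u) :
    w.map L x = (x + w.s) % L := by
  simp [Swap.map, h]

theorem Swap.map_of_eq_v {L : ℕ} {w : Swap} {x : ℕ} (huv : w.u ≠ w.v) (h : x % w.q = w.v) :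
    w.map L x = (x + (L - w.s)) % L := by
  rw [Swap.map, h, natBeq_of_ne huv.symm, cond_false, Nat.beq_refl, cond_true]

theorem Swap.map_of_ne {L : ℕ} {w : Swap} {x : ℕ} (hu : x % w.q ≠ w.u) (hv : x % w.q ≠ w.v) :
    w.map L x = x := by
  rw [Swap.map, natBeq_of_ne hu, natBeq_of_ne hv, cond_false, cond_false]

theorem mod_sub_add {q L s u v x : ℕ} (hq : q ∣ L) (hu : u < q) (hs : s ≤ L)
    (huv : (u + s) % q = v) (hx : x % q = v) : (x + (L - s)) % q = u := by
  have h1 : x + (L - s) + s ≡ u + s [MOD q] := by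
    have h2 : x + (L - s) + s = x + L := by omega
    rw [h2]
    have h3 : x + L ≡ x + 0 [MOD q] := Nat.ModEq.add_left x (Nat.modEq_zero_iff_dvd.2 hq)
    refine h3.trans ?_
    change x % q = (u + s) % q
    rw [hx, huv]
  have h4 : x + (L - s) ≡ u [MOD q] := Nat.ModEq.add_right_cancel' s h1
  rw [h4, Nat.mod_eq_of_lt hu]

theorem Swap.Valid.map_congr {L : ℕ} {ds : List ℕ} {w : Swap} (hw : w.Valid L ds) {d x y : ℕ}
    (hd : d ∈ ds) (h : x % d = y % d) : w.map L x % d = w.map L y % d := by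
  obtain ⟨hq, hu, hv, huv, hs, hsL, hds⟩ := hw
  obtain ⟨hdL, hqd | hds⟩ := hds d hd
  · have hq' : x % w.q = y % w.q := (Nat.ModEq.of_dvd hqd (show x ≡ y [MOD d] from h))
    by_cases h1 : x % w.q = w.u
    · rw [Swap.map_of_eq_u h1, Swap.map_of_eq_u (hq' ▸ h1), Nat.mod_mod_of_dvd _ hdL,
        Nat.mod_mod_of_dvd _ hdL]
      exact Nat.ModEq.add_right (n := d) _ h
    · by_cases h2 : x % w.q = w.v
      · rw [Swap.map_of_eq_v huv h2, Swap.map_of_eq_v huv (hq' ▸ h2), Nat.mod_mod_of_dvd _ hdL,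
          Nat.mod_mod_of_dvd _ hdL]
        exact Nat.ModEq.add_right (n := d) _ h
      · rw [Swap.map_of_ne h1 h2, Swap.map_of_ne (hq' ▸ h1) (hq' ▸ h2), h]
  · have key : ∀ z, w.map L z % d = z % d := by
      intro z
      by_cases h1 : z % w.q = w.u
      · rw [Swap.map_of_eq_u h1, Nat.mod_mod_of_dvd _ hdL]
        exact Nat.ModEq.add_left (n := d) z (Nat.modEq_zero_iff_dvd.2 hds)
      · by_cases h2 : z % w.q = w.v
        · rw [Swap.map_of_eq_v huv h2, Nat.mod_mod_of_dvd _ hdL]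
          exact Nat.ModEq.add_left (n := d) z (Nat.modEq_zero_iff_dvd.2 (Nat.dvd_sub hdL hds))
        · rw [Swap.map_of_ne h1 h2]
    rw [key, key, h]

theorem Swap.Valid.map_map {L : ℕ} {ds : List ℕ} {w : Swap} (hw : w.Valid L ds) {x : ℕ}
    (hx : x < L) : w.map L (w.map L x) = x := by
  obtain ⟨hq, hu, hv, huv, hs, hsL, -⟩ := hw
  by_cases h1 : x % w.q = w.u
  · have h2 : (x + w.s) % L % w.q = w.v := by
      rw [Nat.mod_mod_of_dvd _ hq, ← hs, ← h1, Nat.mod_add_mod]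
    rw [Swap.map_of_eq_u h1, Swap.map_of_eq_v huv h2, Nat.mod_add_mod]
    rw [show x + w.s + (L - w.s) = x + L by omega, Nat.add_mod_right, Nat.mod_eq_of_lt hx]
  · by_cases h2 : x % w.q = w.v
    · have h3 : (x + (L - w.s)) % L % w.q = w.u := by
        rw [Nat.mod_mod_of_dvd _ hq]
        exact mod_sub_add hq hu hsL hs h2
      rw [Swap.map_of_eq_v huv h2, Swap.map_of_eq_u h3, Nat.mod_add_mod]
      rw [show x + (L - w.s) + w.s = x + L by omega, Nat.add_mod_right, Nat.mod_eq_of_lt hx]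
    · rw [Swap.map_of_ne h1 h2, Swap.map_of_ne h1 h2]

/-- Multiplication by 2^(12s) modulo 2^(12L) - 1 rotates the L digits cyclically by s places. -/
theorem pack_mul_mod (S : Finset ℕ) {L s : ℕ} (hS : S ⊆ range L) (hL : 0 < L) :
    pack S * 2 ^ (12 * s) % (2 ^ (12 * L) - 1) = pack (S.image (fun x => (x + s) % L)) := by
  have hinj : Set.InjOn (fun x => (x + s) % L) S := by
    intro x hx y hy h
    have hx := mem_range.1 (hS hx)
    have hy := mem_range.1 (hS hy)
    have h' : x ≡ y [MOD L] := Nat.ModEq.add_right_cancel' s h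
    rwa [Nat.ModEq, Nat.mod_eq_of_lt hx, Nat.mod_eq_of_lt hy] at h'
  have hmod : pack S * 2 ^ (12 * s) ≡ pack (S.image (fun x => (x + s) % L))
      [MOD 2 ^ (12 * L) - 1] := by
    rw [pack, pack, sum_image hinj, sum_mul]
    apply Nat.ModEq.sum
    intro x _
    have h : (2 ^ (12 * L)) ^ ((x + s) / L) ≡ 1 ^ ((x + s) / L) [MOD 2 ^ (12 * L) - 1] := by
      apply Nat.ModEq.pow
      exact ((Nat.modEq_iff_dvd' Nat.one_le_two_pow).2 dvd_rfl).symm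
    have h2 : 2 ^ (12 * x) * 2 ^ (12 * s)
        = (2 ^ (12 * L)) ^ ((x + s) / L) * 2 ^ (12 * ((x + s) % L)) := by
      rw [← pow_mul, ← pow_add, ← pow_add]
      congr 1
      have := Nat.div_add_mod (x + s) L
      calc 12 * x + 12 * s = 12 * (x + s) := by ring
        _ = 12 * (L * ((x + s) / L) + (x + s) % L) := by rw [this]
        _ = _ := by ring
    rw [h2]
    simpa using h.mul_right (2 ^ (12 * ((x + s) % L)))
  rw [hmod, Nat.mod_eq_of_lt]
  refine lt_of_le_of_lt ?_ (sum_pow_lt (c := fun _ => 1) hL (fun _ _ => by norm_num))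
  simp only [one_mul]
  apply sum_le_sum_of_subset
  intro x hx
  obtain ⟨y, -, rfl⟩ := mem_image.1 hx
  exact mem_range.2 (Nat.mod_lt _ hL)

theorem inter_residueClass {S : Finset ℕ} {L : ℕ} (hS : S ⊆ range L) (d r : ℕ) :
    S ∩ residueClass L d r = {x ∈ S | x % d = r} := by
  ext x
  simp only [mem_inter, residueClass, mem_filter]
  exact ⟨fun h => ⟨h.1, h.2.2⟩, fun h => ⟨h.1, hS h.1, h.2⟩⟩

/-- The test compares only the image of the u-part of S with its v-part. That suffices, because the
shift back from v to u is the inverse rotation. -/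
theorem Swap.Valid.map_mem {L : ℕ} {ds : List ℕ} {w : Swap} (hw : w.Valid L ds) {S : Finset ℕ}
    (hS : S ⊆ range L) (hinv : w.invariant L (pack S) = true) {x : ℕ} (hx : x ∈ S) :
    w.map L x ∈ S := by
  have hL : 0 < L := lt_of_le_of_lt (Nat.zero_le _) (mem_range.1 (hS hx))
  have hxL := mem_range.1 (hS hx)
  have hmm := hw.map_map hxL
  obtain ⟨hq, hu, hv, huv, hs, hsL, -⟩ := hw
  have h := Nat.eq_of_beq_eq_true hinv
  rw [classMask_eq_pack hq hu, classMask_eq_pack hq hv, land_pack, land_pack,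
    inter_residueClass hS, inter_residueClass hS,
    pack_mul_mod _ ((filter_subset _ _).trans hS) hL] at h
  have h := pack_injective h
  by_cases h1 : x % w.q = w.u
  · rw [Swap.map_of_eq_u h1]
    have : (x + w.s) % L ∈ {x ∈ S | x % w.q = w.v} := by
      rw [← h]
      exact mem_image_of_mem _ (mem_filter.2 ⟨hx, h1⟩)
    exact (mem_filter.1 this).1
  · by_cases h2 : x % w.q = w.v
    · have : x ∈ {x ∈ S | x % w.q = w.v} := mem_filter.2 ⟨hx, h2⟩
      rw [← h] at this
      obtain ⟨y, hy, hyx⟩ := mem_image.1 this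
      obtain ⟨hyS, hyu⟩ := mem_filter.1 hy
      have hyL := mem_range.1 (hS hyS)
      have h3 : w.map L y = x := by rw [Swap.map_of_eq_u hyu]; exact hyx
      rw [Swap.map_of_eq_v huv h2]
      have h4 : (x + (L - w.s)) % L = y := by
        rw [← hyx]
        rw [Nat.mod_add_mod, show y + w.s + (L - w.s) = y + L by omega, Nat.add_mod_right,
          Nat.mod_eq_of_lt hyL]
      rw [h4]
      exact hyS
    · rwa [Swap.map_of_ne h1 h2]

/-- A choice of residues covering `S` remains one after applying a swap that preserves `S`. -/
theorem Swap.Valid.cover_map {L : ℕ} {ds : List ℕ} {w : Swap} (hw : w.Valid L ds) {S : Finset ℕ}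
    (hS : S ⊆ range L) (hinv : w.invariant L (pack S) = true) {R : ℕ → ℕ}
    (hR : ∀ x ∈ S, ∃ d ∈ ds, x % d = R d % d) :
    ∀ x ∈ S, ∃ d ∈ ds, x % d = w.map L (R d) % d := by
  intro x hx
  obtain ⟨d, hd, h⟩ := hR _ (hw.map_mem hS hinv hx)
  refine ⟨d, hd, ?_⟩
  rw [← hw.map_congr hd h, hw.map_map (mem_range.1 (hS hx))]

/-! ### Normalized residues and soundness of the search -/

theorem mem_invariantSwaps {L U d : ℕ} {W : List Swap} {w : Swap}
    (h : w ∈ invariantSwaps L U d W) : w ∈ W ∧ w.invariant L U = true := by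
  induction W with
  | nil => simp [invariantSwaps] at h
  | cons a l ih =>
    rw [invariantSwaps] at h
    cases hb : (Nat.beq (d % a.q) 0 && a.invariant L U) with
    | true =>
      rw [hb, cond_true, List.mem_cons] at h
      rcases h with rfl | h
      · exact ⟨List.mem_cons_self, (Bool.and_eq_true_iff.1 hb).2⟩
      · exact ⟨List.mem_cons_of_mem _ (ih h).1, (ih h).2⟩
    | false =>
      rw [hb, cond_false] at h
      exact ⟨List.mem_cons_of_mem _ (ih h).1, (ih h).2⟩

theorem cover_normalizeResidue {L : ℕ} {ds : List ℕ} {S : Finset ℕ} (hS : S ⊆ range L)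
    {W : List Swap} (hW : ∀ w ∈ W, w.Valid L ds ∧ w.invariant L (pack S) = true) {d r : ℕ}
    (h : ∃ R : ℕ → ℕ, R d = r ∧ ∀ x ∈ S, ∃ d ∈ ds, x % d = R d % d) :
    ∃ R : ℕ → ℕ, R d = normalizeResidue L W r ∧ ∀ x ∈ S, ∃ d ∈ ds, x % d = R d % d := by
  induction W generalizing r with
  | nil => exact h
  | cons w l ih =>
    have ih := fun r => ih (r := r) (fun w hw => hW w (List.mem_cons_of_mem _ hw))
    rw [normalizeResidue]
    cases Nat.beq (r % w.q) w.u with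
    | false => exact ih _ h
    | true =>
      apply ih
      obtain ⟨R, rfl, hR⟩ := h
      obtain ⟨hv, hinv⟩ := hW w List.mem_cons_self
      exact ⟨fun d => w.map L (R d), rfl, hv.cover_map hS hinv hR⟩

theorem memList_iff {r : ℕ} {l : List ℕ} : memList r l = true ↔ r ∈ l := by
  induction l with
  | nil => simp [memList]
  | cons a l ih => simp [memList, ih]

theorem allList_iff {p : ℕ → Bool} {l : List ℕ} : allList p l = true ↔ ∀ r ∈ l, p r = true := by
  induction l with
  | nil => simp [allList]
  | cons a l ih => simp [allList, ih]

theorem mem_representatives {L U d : ℕ} {W : List Swap} {n r : ℕ} (hr : r < n) :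
    Nat.land U (classMask L d (normalizeResidue L W r % d)) = 0 ∨
      normalizeResidue L W r % d ∈ representatives L U d W n := by
  induction n with
  | zero => omega
  | succ n ih =>
    rw [representatives]
    cases hb : (Nat.beq (Nat.land U (classMask L d (normalizeResidue L W n % d))) 0 ||
        memList (normalizeResidue L W n % d) (representatives L U d W n)) with
    | true =>
      rw [cond_true]
      rcases Nat.lt_succ_iff_lt_or_eq.1 hr with h | rfl
      · exact ih h
      · rw [Bool.or_eq_true, memList_iff] at hb
        exact hb.imp_left Nat.eq_of_beq_eq_true
    | false =>
      rw [cond_false]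
      rcases Nat.lt_succ_iff_lt_or_eq.1 hr with h | rfl
      · exact (ih h).imp_right (List.mem_cons_of_mem _)
      · exact Or.inr List.mem_cons_self

theorem representatives_lt {L U d : ℕ} {W : List Swap} {n r : ℕ} (hd : 0 < d)
    (h : r ∈ representatives L U d W n) : r < d := by
  induction n with
  | zero => simp [representatives] at h
  | succ n ih =>
    rw [representatives] at h
    cases hb : (Nat.beq (Nat.land U (classMask L d (normalizeResidue L W n % d))) 0 ||
        memList (normalizeResidue L W n % d) (representatives L U d W n)) with
    | true =>
      rw [hb, cond_true] at h
      exact ih h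
    | false =>
      rw [hb, cond_false, List.mem_cons] at h
      rcases h with rfl | h
      · exact Nat.mod_lt _ hd
      · exact ih h

theorem card_le_capSum {S : Finset ℕ} {caps : List (ℕ × ℕ)}
    (hcaps : ∀ c ∈ caps, ∀ r, #{x ∈ S | x % c.1 = r} ≤ c.2)
    (hS : Coverable S (caps.map Prod.fst)) : #S ≤ capSum caps := by
  obtain ⟨R, hR⟩ := hS
  induction caps generalizing S with
  | nil =>
    have : S = ∅ := eq_empty_of_forall_notMem fun x hx => by simpa using hR x hx
    simp [this]
  | cons c l ih =>
    have h1 := ih (S := {x ∈ S | ¬ x % c.1 = R c.1 % c.1})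
      (fun e he r => (card_le_card (filter_subset_filter _ (filter_subset _ _))).trans
        (hcaps e (List.mem_cons_of_mem _ he) r))
      (fun x hx => by
        obtain ⟨hx, hxc⟩ := mem_filter.1 hx
        obtain ⟨d, hd, h⟩ := hR x hx
        rw [List.map_cons, List.mem_cons] at hd
        rcases hd with rfl | hd
        · exact absurd h hxc
        · exact ⟨d, hd, h⟩)
    have h2 := hcaps c List.mem_cons_self (R c.1 % c.1)
    have h3 := card_filter_add_card_filter_not (s := S) (fun x => x % c.1 = R c.1 % c.1)
    rw [capSum]
    omega

theorem map_fst_tightenCaps (U : ℕ) (caps : List (ℕ × ℕ)) :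
    (tightenCaps U caps).map Prod.fst = caps.map Prod.fst := by
  induction caps with
  | nil => rfl
  | cons c l ih => simp [tightenCaps, ih]

theorem tightenCaps_sound {S : Finset ℕ} (hS : #S ≤ 2047) {caps : List (ℕ × ℕ)}
    (hcaps : ∀ c ∈ caps, 0 < c.1 ∧ ∀ r, #{x ∈ S | x % c.1 = r} ≤ c.2) :
    ∀ c ∈ tightenCaps (pack S) caps, 0 < c.1 ∧ ∀ r, #{x ∈ S | x % c.1 = r} ≤ c.2 := by
  induction caps with
  | nil => exact hcaps
  | cons c l ih =>
    intro e he
    rw [tightenCaps, List.mem_cons] at he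
    rcases he with rfl | he
    · obtain ⟨h1, h2⟩ := hcaps c List.mem_cons_self
      exact ⟨h1, tightenCap_sound hS h1 _ h2⟩
    · exact ih (fun c hc => hcaps c (List.mem_cons_of_mem _ hc)) e he

theorem Coverable.sdiff {S T : Finset ℕ} {d : ℕ} {ds : List ℕ} {R : ℕ → ℕ}
    (hR : ∀ x ∈ S, ∃ e ∈ d :: ds, x % e = R e % e) (hT : ∀ x ∈ S, x % d = R d % d → x ∈ T) :
    Coverable (S \ T) ds := by
  refine ⟨R, fun x hx => ?_⟩
  obtain ⟨hx, hxT⟩ := mem_sdiff.1 hx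
  obtain ⟨e, he, h⟩ := hR x hx
  rcases List.mem_cons.1 he with rfl | he
  · exact absurd (hT x hx h) hxT
  · exact ⟨e, he, h⟩

/-- Some choice of a representative residue class for the first modulus leaves a set which the
other moduli can cover. -/
theorem exists_representative {L d : ℕ} {ds : List ℕ} {S : Finset ℕ} (hd : 0 < d)
    (hdL : d ∣ L) (hS : S ⊆ range L) {W : List Swap}
    (hW : ∀ w ∈ W, w.Valid L (d :: ds)) (h : Coverable S (d :: ds))
    (hne : 1 ≤ (representatives L (pack S) d (invariantSwaps L (pack S) d W) d).length) :
    ∃ r ∈ representatives L (pack S) d (invariantSwaps L (pack S) d W) d,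
      Coverable (S \ residueClass L d r) ds := by
  obtain ⟨R, hR⟩ := h
  set V := invariantSwaps L (pack S) d W with hV
  -- Residues are reduced first, since `representatives` only normalizes numbers below d.
  have hR' : ∀ x ∈ S, ∃ e ∈ d :: ds, x % e = (R e % e) % e := by simpa using hR
  obtain ⟨Q, hQ, hQc⟩ := cover_normalizeResidue (d := d) hS (W := V)
    (fun w hw => ⟨hW w (mem_invariantSwaps hw).1, (mem_invariantSwaps hw).2⟩)
    ⟨fun e => R e % e, rfl, hR'⟩
  rcases mem_representatives (L := L) (U := pack S) (d := d) (W := V)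
    (Nat.mod_lt (R d) hd) with h0 | hmem
  -- Here the class chosen modulo d misses S, so the other moduli already cover S and any
  -- representative may stand in for it. This is why the list must be nonempty.
  · obtain ⟨r, hr⟩ := List.exists_mem_of_length_pos hne
    refine ⟨r, hr, Coverable.sdiff hQc fun x hx hxd => ?_⟩
    rw [classMask_eq_pack hdL (Nat.mod_lt _ hd), land_pack] at h0
    have : x ∈ S ∩ residueClass L d (normalizeResidue L V (R d % d) % d) := by
      rw [inter_residueClass hS]
      exact mem_filter.2 ⟨hx, by rw [hxd, hQ]⟩
    rw [pack_eq_zero h0] at this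
    simp at this
  · refine ⟨_, hmem, Coverable.sdiff hQc fun x hx hxd => ?_⟩
    exact mem_filter.2 ⟨hS hx, by rw [hxd, hQ]⟩

/-- Induction on the fuel: a cap sum below the cardinality contradicts the union bound, and
otherwise some branch of the search would again be coverable. Caps computed for a set remain valid
for its subsets, so tightened caps are passed down. -/
theorem refute_sound {L : ℕ} (hL : L ≤ 2047) {W : List Swap} (f : ℕ) {caps : List (ℕ × ℕ)}
    {S : Finset ℕ} (hS : S ⊆ range L) (hW : ∀ w ∈ W, w.Valid L (caps.map Prod.fst))
    (hdvd : ∀ c ∈ caps, c.1 ∣ L)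
    (hcaps : ∀ c ∈ caps, 0 < c.1 ∧ ∀ r, #{x ∈ S | x % c.1 = r} ≤ c.2)
    (h : refute L W f caps (pack S) = true) : ¬ Coverable S (caps.map Prod.fst) := by
  intro hcov
  induction f generalizing caps S with
  | zero => simp [refute] at h
  | succ f ih =>
    have hcard : #S ≤ 2047 := (card_le_card hS).trans (by simpa using hL)
    have htight := tightenCaps_sound hcard hcaps
    have hmap := map_fst_tightenCaps (pack S) caps
    rw [refute, pack_mod_eq_card S hcard] at h
    have h1 := card_le_capSum (fun c hc => (hcaps c hc).2) hcov
    have h2 := card_le_capSum (fun c hc => (htight c hc).2) (by rwa [hmap])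
    have hb1 : Nat.ble (capSum caps + 1) #S = false := by
      rw [Bool.eq_false_iff]
      intro hb
      have := Nat.le_of_ble_eq_true hb
      omega
    have hb2 : Nat.ble (capSum (tightenCaps (pack S) caps) + 1) #S = false := by
      rw [Bool.eq_false_iff]
      intro hb
      have := Nat.le_of_ble_eq_true hb
      omega
    rw [hb1, hb2, cond_false, cond_false] at h
    generalize tightenCaps (pack S) caps = tcaps at *
    cases tcaps with
    | nil => simp at h
    | cons c rest =>
      rw [← hmap] at hcov hW
      have hdvd' : ∀ e ∈ c :: rest, e.1 ∣ L := by
        intro e he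
        have : e.1 ∈ caps.map Prod.fst := by rw [← hmap]; exact List.mem_map_of_mem he
        obtain ⟨e', he', heq⟩ := List.mem_map.1 this
        rw [← heq]
        exact hdvd e' he'
      simp only [] at h
      cases hb : Nat.ble 1
          (representatives L (pack S) c.1 (invariantSwaps L (pack S) c.1 W) c.1).length with
      | false => simp [hb] at h
      | true =>
        rw [hb, cond_true, allList_iff] at h
        have hc := (htight c List.mem_cons_self).1
        have hcL := hdvd' c List.mem_cons_self
        obtain ⟨r, hr, hcov'⟩ := exists_representative hc hcL hS hW hcov
          (Nat.le_of_ble_eq_true hb)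
        have h' := h r hr
        rw [classMask_eq_pack hcL (representatives_lt hc hr), pack_sub_land] at h'
        refine ih (caps := rest) (sdiff_subset.trans hS) ?_
          (fun e he => hdvd' e (List.mem_cons_of_mem _ he)) ?_ h' hcov'
        · intro w hw
          obtain ⟨a1, a2, a3, a4, a5, a6, a7⟩ := hW w hw
          exact ⟨a1, a2, a3, a4, a5, a6, fun d hd => a7 d (List.mem_cons_of_mem _ hd)⟩
        · intro e he
          obtain ⟨e1, e2⟩ := htight e (List.mem_cons_of_mem _ he)
          exact ⟨e1, fun r => (card_le_card (filter_subset_filter _ sdiff_subset)).trans (e2 r)⟩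

theorem card_residueClass_le {d n r : ℕ} : #(residueClass (d * n) d r) ≤ n := by
  have : Set.InjOn (fun x => x / d) (residueClass (d * n) d r) := by
    intro x hx y hy h
    rw [← Nat.div_add_mod x d, ← Nat.div_add_mod y d, (mem_filter.1 hx).2, (mem_filter.1 hy).2]
    simp only [] at h
    rw [h]
  have hmaps : Set.MapsTo (fun x => x / d) (residueClass (d * n) d r) (range n) := by
    intro x hx
    exact mem_coe.2 (mem_range.2 (Nat.div_lt_of_lt_mul (mem_range.1 (mem_filter.1 hx).1)))
  simpa using card_le_card_of_injOn _ hmaps this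

/-- Each modulus with the size of its residue classes in `range L`. -/
def initialCaps (L : ℕ) (ds : List ℕ) : List (ℕ × ℕ) := ds.map fun d => (d, L / d)

theorem not_coverable_of_refute {L : ℕ} (hL0 : 0 < L) (hL : L ≤ 2047) {W : List Swap}
    {ds : List ℕ} (hW : ∀ w ∈ W, w.Valid L ds) (hdvd : ∀ d ∈ ds, d ∣ L)
    (h : refute L W ds.length (initialCaps L ds) ((2 ^ (12 * L) - 1) / 4095) = true) :
    ¬ Coverable (range L) ds := by
  have hmap : (initialCaps L ds).map Prod.fst = ds := by
    simp [initialCaps, Function.comp_def]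
  rw [← hmap] at hW ⊢
  have hpack : (2 ^ (12 * L) - 1) / 4095 = pack (range L) := by
    have := geom_sum_pow 1 L one_pos
    simpa [pack] using this
  rw [hpack] at h
  refine refute_sound hL _ subset_rfl hW ?_ ?_ h
  · intro c hc
    obtain ⟨d, hd, rfl⟩ := List.mem_map.1 hc
    exact hdvd d hd
  · intro c hc
    obtain ⟨d, hd, rfl⟩ := List.mem_map.1 hc
    have hd0 : 0 < d := Nat.pos_of_dvd_of_pos (hdvd d hd) hL0
    refine ⟨hd0, fun r => ?_⟩
    obtain ⟨n, rfl⟩ := hdvd d hd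
    rw [Nat.mul_div_cancel_left n hd0]
    exact card_residueClass_le

/-! ### From covering systems to finite refutations -/

theorem IsDistinctCoveringWith.dvd {m N : ℕ} {C : Finset (ℕ × ℤ)}
    (h : IsDistinctCoveringWith m N C) {p : ℕ × ℤ} (hp : p ∈ C) : p.1 ∣ N := by
  rw [← h.2.2]
  exact dvd_lcm hp

theorem IsDistinctCoveringWith.coverable {m N L : ℕ} {C : Finset (ℕ × ℤ)}
    (h : IsDistinctCoveringWith m N C) (hNL : N ∣ L) {ds : List ℕ}
    (hds : ∀ d, d ∣ L → m ≤ d → d ∈ ds) : Coverable (range L) ds := by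
  classical
  have hmem : ∀ n, ∃ r : ℤ, ∀ p ∈ C, p.1 = n → p.2 = r := by
    intro n
    by_cases hn : ∃ p ∈ C, p.1 = n
    · obtain ⟨p, hp, rfl⟩ := hn
      exact ⟨p.2, fun q hq hqp => by rw [h.1.2.1 q hq p hp hqp]⟩
    -- If n is not a modulus its residue is irrelevant; an additional class cannot spoil a cover.
    · exact ⟨0, fun p hp hpn => absurd ⟨p, hp, hpn⟩ hn⟩
  choose r hr using hmem
  refine ⟨fun n => (r n % n).toNat, fun x _ => ?_⟩
  obtain ⟨p, hp, hx⟩ := h.1.2.2 x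
  refine ⟨p.1, hds _ ((h.dvd hp).trans hNL) (h.2.1.2 ⟨p, hp, rfl⟩), ?_⟩
  have h1 := h.1.1 p hp
  have h2 : (0 : ℤ) ≤ r p.1 % p.1 := Int.emod_nonneg _ (by omega)
  zify
  rw [Int.toNat_of_nonneg h2, Int.emod_emod_of_dvd _ dvd_rfl, ← hr p.1 p hp rfl]
  exact hx

/-- The divisors of `L` that are at least `m`. -/
def divisorsFrom (m L : ℕ) : List ℕ :=
  (List.range (L + 1)).filter fun d => Nat.beq (L % d) 0 && Nat.ble m d

theorem mem_divisorsFrom {m L : ℕ} (hL : 0 < L) {d : ℕ} :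
    d ∈ divisorsFrom m L ↔ d ∣ L ∧ m ≤ d := by
  simp only [divisorsFrom, List.mem_filter, List.mem_range, Bool.and_eq_true, Nat.ble_eq,
    Nat.beq_eq, Nat.lt_succ_iff, ← Nat.dvd_iff_mod_eq_zero]
  exact ⟨fun h => h.2, fun h => ⟨Nat.le_of_dvd hL h.1, h⟩⟩

/-- The swaps of sibling classes modulo the powers of `p` up to `p ^ e`, where `c` is `1` modulo
`p ^ e` and `0` modulo `L / p ^ e`. -/
def siblingSwaps (L p e c : ℕ) : List Swap :=
  (List.range e).flatMap fun j => (List.range (p ^ j)).flatMap fun a =>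
    (List.range p).flatMap fun i => (List.range (p - 1 - i)).map fun k =>
      ⟨p ^ (j + 1), a + (i + 1 + k) * p ^ j, a + i * p ^ j, L - c * (k + 1) * p ^ j % L⟩

theorem not_covering_of_refute {m N L : ℕ} {C : Finset (ℕ × ℤ)} (hNL : N ∣ L) (hL0 : 0 < L)
    (hL : L ≤ 2047) {W : List Swap} (hW : ∀ w ∈ W, w.Valid L (divisorsFrom m L))
    (hr : refute L W (divisorsFrom m L).length (initialCaps L (divisorsFrom m L))
      ((2 ^ (12 * L) - 1) / 4095) = true) : ¬ IsDistinctCoveringWith m N C := fun h =>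
  not_coverable_of_refute hL0 hL hW (fun _ hd => ((mem_divisorsFrom hL0).1 hd).1) hr
    (h.coverable hNL fun _ h1 h2 => (mem_divisorsFrom hL0).2 ⟨h1, h2⟩)

theorem not_covering_of_dvd_720 {N : ℕ} {C : Finset (ℕ × ℤ)} (hN : N ∣ 720) :
    ¬ IsDistinctCoveringWith 5 N C :=
  not_covering_of_refute hN (by norm_num) (by norm_num)
    -- By the Chinese remainder theorem, 225, 640, 576 are 1 modulo 16, 9, 5 and 0 modulo 45, 80,
    -- 144. The constants for 1080 and 1800 arise in the same way.
    (W := siblingSwaps 720 2 4 225 ++ siblingSwaps 720 3 2 640 ++ siblingSwaps 720 5 1 576)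
    (by decide +kernel) (by decide +kernel)

theorem not_covering_of_dvd_1080 {N : ℕ} {C : Finset (ℕ × ℤ)} (hN : N ∣ 1080) :
    ¬ IsDistinctCoveringWith 5 N C :=
  not_covering_of_refute hN (by norm_num) (by norm_num)
    (W := siblingSwaps 1080 2 3 945 ++ siblingSwaps 1080 3 3 1000 ++ siblingSwaps 1080 5 1 216)
    (by decide +kernel) (by decide +kernel)

theorem not_covering_of_dvd_1800 {N : ℕ} {C : Finset (ℕ × ℤ)} (hN : N ∣ 1800) :
    ¬ IsDistinctCoveringWith 5 N C :=
  not_covering_of_refute hN (by norm_num) (by norm_num)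
    (W := siblingSwaps 1800 2 3 225 ++ siblingSwaps 1800 3 2 1000 ++ siblingSwaps 1800 5 2 576)
    (by decide +kernel) (by decide +kernel)

/-! ### Excluding type (a,1,1) by counting -/

/-- As d is prime to 5, a class modulo d meets each of the m blocks of 5d consecutive integers once
per residue modulo 5; one of the five residues is removed. -/
theorem card_sdiff_residueClass_le {d m r s : ℕ} (hd : Nat.Coprime d 5) (hr : r < 5) :
    #{x ∈ range (5 * (d * m)) \ residueClass (5 * (d * m)) 5 r | x % d = s} ≤ 4 * m := by
  have hmaps : Set.MapsTo (fun x => (x % 5, x / (d * 5)))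
      ({x ∈ range (5 * (d * m)) \ residueClass (5 * (d * m)) 5 r | x % d = s} : Finset ℕ)
      (((range 5).erase r) ×ˢ range m : Finset (ℕ × ℕ)) := by
    intro x hx
    obtain ⟨hx, -⟩ := mem_filter.1 (mem_coe.1 hx)
    obtain ⟨hxL, hx⟩ := mem_sdiff.1 hx
    rw [mem_coe, mem_product, mem_erase, mem_range, mem_range]
    refine ⟨⟨fun h => hx (mem_filter.2 ⟨hxL, h⟩), Nat.mod_lt _ (by norm_num)⟩, ?_⟩
    apply Nat.div_lt_of_lt_mul
    have := mem_range.1 hxL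
    calc x < 5 * (d * m) := this
      _ = d * 5 * m := by ring
  have hinj : Set.InjOn (fun x => (x % 5, x / (d * 5)))
      ({x ∈ range (5 * (d * m)) \ residueClass (5 * (d * m)) 5 r | x % d = s} : Finset ℕ) := by
    intro x hx y hy h
    have hxs := (mem_filter.1 (mem_coe.1 hx)).2
    have hys := (mem_filter.1 (mem_coe.1 hy)).2
    obtain ⟨h1, h2⟩ := Prod.mk.inj h
    have h3 : x ≡ y [MOD d * 5] :=
      (Nat.modEq_and_modEq_iff_modEq_mul hd).1 ⟨hxs.trans hys.symm, h1⟩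
    rw [← Nat.div_add_mod x (d * 5), ← Nat.div_add_mod y (d * 5), h2, h3]
  have := card_le_card_of_injOn _ hmaps hinj
  rwa [card_product, card_range, card_erase_of_mem (mem_range.2 hr), card_range] at this

theorem capSum_append (l₁ l₂ : List (ℕ × ℕ)) : capSum (l₁ ++ l₂) = capSum l₁ + capSum l₂ := by
  induction l₁ with
  | nil => simp [capSum]
  | cons c l ih => rw [List.cons_append, capSum, capSum, ih, add_assoc]

/-- Adding the remainder k·2^(m+1-n) makes the geometric sum telescope without subtraction. -/
theorem capSum_geometric (f : ℕ → ℕ) (k m n : ℕ) (hn : n ≤ m + 1) :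
    capSum ((List.range n).map fun j => (f j, k * 2 ^ (m - j))) + k * 2 ^ (m + 1 - n)
      = k * 2 ^ (m + 1) := by
  induction n with
  | zero => simp [capSum]
  | succ n ih =>
    have ih := ih (by omega)
    rw [List.range_succ, List.map_append, capSum_append]
    simp only [List.map_cons, List.map_nil, capSum]
    rw [show m + 1 - n = (m - n) + 1 by omega, pow_succ] at ih
    rw [show m + 1 - (n + 1) = m - n by omega]
    linarith

/-- The divisors of `2 ^ (a + 2) * 15` greater than `5`, each with the largest possible number of
elements of a residue class in `range (2 ^ (a + 2) * 15)` outside a fixed class modulo `5`. -/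
def capsOffFive (a : ℕ) : List (ℕ × ℕ) :=
  ((List.range a).map fun j => (8 * 2 ^ j, 6 * 2 ^ (a - j))) ++
  ((List.range (a + 2)).map fun j => (6 * 2 ^ j, 4 * 2 ^ (a + 1 - j))) ++
  ((List.range (a + 2)).map fun j => (10 * 2 ^ j, 3 * 2 ^ (a + 1 - j))) ++
  ((List.range (a + 3)).map fun j => (15 * 2 ^ j, 1 * 2 ^ (a + 2 - j)))

/-- With j unbounded the four families would total (12 + 16 + 12 + 8)·2^a = 48·2^a, which is 4/5 of
2^(a+2)·15; only the truncation of the sums makes the inequality strict. -/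
theorem capSum_capsOffFive (a : ℕ) : capSum (capsOffFive a) < 48 * 2 ^ a := by
  have h1 := capSum_geometric (fun j => 8 * 2 ^ j) 6 a a (by omega)
  have h2 := capSum_geometric (fun j => 6 * 2 ^ j) 4 (a + 1) (a + 2) (by omega)
  have h3 := capSum_geometric (fun j => 10 * 2 ^ j) 3 (a + 1) (a + 2) (by omega)
  have h4 := capSum_geometric (fun j => 15 * 2 ^ j) 1 (a + 2) (a + 3) (by omega)
  have e1 : a + 1 - a = 1 := by omega
  simp only [e1, Nat.sub_self, add_assoc, Nat.reduceAdd, pow_zero, pow_one] at h1 h2 h3 h4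
  rw [capsOffFive, capSum_append, capSum_append, capSum_append]
  have p1 : 2 ^ (a + 1) = 2 * 2 ^ a := by ring
  have p2 : 2 ^ (a + 2) = 4 * 2 ^ a := by ring
  have p3 : 2 ^ (a + 3) = 8 * 2 ^ a := by ring
  omega

theorem mem_of_dvd_two_pow_mul_fifteen {a d : ℕ} (h : d ∣ 2 ^ (a + 2) * 15) (hd : 5 ≤ d) :
    d ∈ 5 :: (capsOffFive a).map Prod.fst := by
  obtain ⟨x, y, hx, hy, rfl⟩ := (Nat.dvd_mul).1 h
  obtain ⟨i, hi, rfl⟩ := (Nat.dvd_prime_pow Nat.prime_two).1 hx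
  have hy' : y ∈ Nat.divisors 15 := Nat.mem_divisors.2 ⟨hy, by norm_num⟩
  rw [show Nat.divisors 15 = {1, 3, 5, 15} by decide +kernel] at hy'
  simp only [capsOffFive, List.map_append, List.map_map, List.mem_cons, List.mem_append,
    List.mem_map, List.mem_range, Function.comp_apply]
  simp only [mem_insert, mem_singleton] at hy'
  rcases hy' with rfl | rfl | rfl | rfl
  · rcases lt_or_ge i 3 with h3 | h3
    · interval_cases i <;> omega
    · obtain ⟨j, rfl⟩ := Nat.exists_eq_add_of_le h3
      exact Or.inr (Or.inl (Or.inl (Or.inl ⟨j, by omega, by ring⟩)))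
  · rcases Nat.eq_zero_or_pos i with rfl | h0
    · omega
    · obtain ⟨j, rfl⟩ := Nat.exists_eq_add_of_le h0
      exact Or.inr (Or.inl (Or.inl (Or.inr ⟨j, by omega, by ring⟩)))
  · rcases Nat.eq_zero_or_pos i with rfl | h0
    · omega
    · obtain ⟨j, rfl⟩ := Nat.exists_eq_add_of_le h0
      exact Or.inr (Or.inl (Or.inr ⟨j, by omega, by ring⟩))
  · exact Or.inr (Or.inr ⟨i, by omega, by ring⟩)

theorem coprime_two_pow_mul {k j : ℕ} (hk : Nat.Coprime k 5) : Nat.Coprime (k * 2 ^ j) 5 :=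
  Nat.Coprime.mul_left hk (Nat.Coprime.pow_left j (by norm_num))

theorem capsOffFive_sound {a r : ℕ} (hr : r < 5) :
    ∀ c ∈ capsOffFive a, ∀ s, #{x ∈ range (2 ^ (a + 2) * 15) \
      residueClass (2 ^ (a + 2) * 15) 5 r | x % c.1 = s} ≤ c.2 := by
  have hsub : ∀ L d s : ℕ, {x ∈ range L \ residueClass L 5 r | x % d = s} ⊆ residueClass L d s :=
    fun L d s => filter_subset_filter _ sdiff_subset
  intro c hc s
  simp only [capsOffFive, List.mem_append, List.mem_map, List.mem_range] at hc
  rcases hc with ((⟨j, hj, rfl⟩ | ⟨j, hj, rfl⟩) | ⟨j, hj, rfl⟩) | ⟨j, hj, rfl⟩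
  · obtain ⟨b, rfl⟩ := Nat.exists_eq_add_of_le hj.le
    have := card_sdiff_residueClass_le (d := 8 * 2 ^ j) (m := 3 * 2 ^ (b - 1)) (s := s)
      (coprime_two_pow_mul (by norm_num)) hr
    obtain ⟨b, rfl⟩ : ∃ e, b = e + 1 := ⟨b - 1, by omega⟩
    rw [show 5 * (8 * 2 ^ j * (3 * 2 ^ (b + 1 - 1))) = 2 ^ (j + (b + 1) + 2) * 15 by
      rw [Nat.add_sub_cancel]; ring] at this
    refine this.trans (le_of_eq ?_)
    rw [Nat.add_sub_cancel, Nat.add_sub_cancel_left]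
    ring
  · obtain ⟨b, hb⟩ := Nat.exists_eq_add_of_le (show j ≤ a + 1 by omega)
    have := card_sdiff_residueClass_le (d := 6 * 2 ^ j) (m := 2 ^ b) (s := s)
      (coprime_two_pow_mul (by norm_num)) hr
    rw [show 5 * (6 * 2 ^ j * 2 ^ b) = 2 ^ (a + 2) * 15 by
      rw [show a + 2 = j + b + 1 by omega]; ring] at this
    simpa only [show a + 1 - j = b by omega] using this
  · obtain ⟨b, hb⟩ := Nat.exists_eq_add_of_le (show j ≤ a + 1 by omega)
    have := card_residueClass_le (d := 10 * 2 ^ j) (n := 3 * 2 ^ b) (r := s)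
    rw [show 10 * 2 ^ j * (3 * 2 ^ b) = 2 ^ (a + 2) * 15 by
      rw [show a + 2 = j + b + 1 by omega]; ring] at this
    simp only [show a + 1 - j = b by omega]
    exact (card_le_card (hsub _ _ _)).trans this
  · obtain ⟨b, hb⟩ := Nat.exists_eq_add_of_le (show j ≤ a + 2 by omega)
    have := card_residueClass_le (d := 15 * 2 ^ j) (n := 2 ^ b) (r := s)
    rw [show 15 * 2 ^ j * 2 ^ b = 2 ^ (a + 2) * 15 by rw [hb]; ring] at this
    simp only [show a + 2 - j = b by omega, one_mul]
    exact (card_le_card (hsub _ _ _)).trans this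

theorem not_covering_two_pow_mul_fifteen {a : ℕ} {C : Finset (ℕ × ℤ)} :
    ¬ IsDistinctCoveringWith 5 (2 ^ a * 15) C := by
  intro h
  -- Enlarging the lcm by a factor 4 makes the powers 8, ..., 2^(a+2) exactly a in number, so small
  -- a need no separate treatment.
  obtain ⟨R, hR⟩ := h.coverable (Nat.mul_dvd_mul_right (pow_dvd_pow 2 (Nat.le_add_right a 2)) 15)
    fun d h1 h2 => mem_of_dvd_two_pow_mul_fifteen h1 h2
  have hr : R 5 % 5 < 5 := Nat.mod_lt _ (by norm_num)
  have hcov := Coverable.sdiff (T := residueClass (2 ^ (a + 2) * 15) 5 (R 5 % 5)) hR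
    fun x hx hx5 => mem_filter.2 ⟨hx, hx5⟩
  have h1 := card_le_capSum (capsOffFive_sound hr) hcov
  have h2 := capSum_capsOffFive a
  have h3 := card_residueClass_le (d := 5) (n := 12 * 2 ^ a) (r := R 5 % 5)
  have h4 := le_card_sdiff (residueClass (2 ^ (a + 2) * 15) 5 (R 5 % 5)) (range (2 ^ (a + 2) * 15))
  rw [show 5 * (12 * 2 ^ a) = 2 ^ (a + 2) * 15 by ring] at h3
  rw [card_range] at h4
  have p2 : 2 ^ (a + 2) = 4 * 2 ^ a := by ring
  omega

/-! ### Explicit coverings and enlarging the lcm -/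

/-- The packed set of elements of `U` outside the classes in `l`. -/
def uncovered (L : ℕ) : List (ℕ × ℕ) → ℕ → ℕ
  | [], U => U
  | p :: l, U => uncovered L l (U - Nat.land U (classMask L p.1 p.2))

theorem exists_mem_of_uncovered {L : ℕ} {l : List (ℕ × ℕ)} (hl : ∀ p ∈ l, p.1 ∣ L ∧ p.2 < p.1)
    {S : Finset ℕ} (h : uncovered L l (pack S) = 0) {x : ℕ} (hx : x ∈ S) :
    ∃ p ∈ l, x % p.1 = p.2 := by
  induction l generalizing S with
  | nil => simp [pack_eq_zero h] at hx
  | cons p l ih =>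
    obtain ⟨h1, h2⟩ := hl p List.mem_cons_self
    rw [uncovered, classMask_eq_pack h1 h2, pack_sub_land] at h
    by_cases hxp : x % p.1 = p.2
    · exact ⟨p, List.mem_cons_self, hxp⟩
    · obtain ⟨q, hq, hxq⟩ := ih (fun q hq => hl q (List.mem_cons_of_mem _ hq)) h
        (mem_sdiff.2 ⟨hx, fun hc => hxp (mem_filter.1 hc).2⟩)
      exact ⟨q, List.mem_cons_of_mem _ hq, hxq⟩

theorem foldr_lcm_dvd {l : List (ℕ × ℕ)} {K : ℕ} (h : ∀ p ∈ l, p.1 ∣ K) :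
    l.foldr (fun p m => Nat.lcm p.1 m) 1 ∣ K := by
  induction l with
  | nil => simp
  | cons p l ih =>
    exact Nat.lcm_dvd (h p List.mem_cons_self) (ih fun q hq => h q (List.mem_cons_of_mem _ hq))

/-- A list of moduli and residues as a finite set of congruences. -/
def congruences (l : List (ℕ × ℕ)) : Finset (ℕ × ℤ) := (l.map fun p => (p.1, (p.2 : ℤ))).toFinset

theorem mem_congruences {l : List (ℕ × ℕ)} {p : ℕ × ℤ} :
    p ∈ congruences l ↔ ∃ q ∈ l, (q.1, (q.2 : ℤ)) = p := by
  rw [congruences, List.mem_toFinset, List.mem_map]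

theorem IsModulus.mem_map_fst {l : List (ℕ × ℕ)} {n : ℕ} (h : IsModulus (congruences l) n) :
    n ∈ l.map Prod.fst := by
  obtain ⟨p, hp, rfl⟩ := h
  obtain ⟨q, hq, rfl⟩ := mem_congruences.1 hp
  exact List.mem_map_of_mem hq

theorem isDistinctCoveringWith_congruences {m L : ℕ} {l : List (ℕ × ℕ)} (hm : 1 < m) (hL : 0 < L)
    (hmem : m ∈ l.map Prod.fst) (hl : ∀ p ∈ l, p.1 ∣ L ∧ p.2 < p.1) (hge : ∀ p ∈ l, m ≤ p.1)
    (hnodup : (l.map Prod.fst).Nodup) (hlcm : l.foldr (fun p m => Nat.lcm p.1 m) 1 = L)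
    (hcov : uncovered L l ((2 ^ (12 * L) - 1) / 4095) = 0) :
    IsDistinctCoveringWith m L (congruences l) := by
  have hpack : (2 ^ (12 * L) - 1) / 4095 = pack (range L) := by
    have := geom_sum_pow 1 L one_pos
    simpa [pack] using this
  rw [hpack] at hcov
  refine ⟨⟨?_, ?_, ?_⟩, ⟨?_, ?_⟩, ?_⟩
  · intro p hp
    obtain ⟨q, hq, rfl⟩ := mem_congruences.1 hp
    exact hm.trans_le (hge q hq)
  · intro p hp p' hp' h
    obtain ⟨q, hq, rfl⟩ := mem_congruences.1 hp
    obtain ⟨q', hq', rfl⟩ := mem_congruences.1 hp'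
    rw [List.inj_on_of_nodup_map hnodup hq hq' h]
  · intro x
    have h0 : (0 : ℤ) ≤ x % L := Int.emod_nonneg _ (by omega)
    have h1 : x % L < L := Int.emod_lt_of_pos _ (by omega)
    -- All moduli divide L, so it suffices to cover the residue of x modulo L.
    obtain ⟨p, hp, hx⟩ := exists_mem_of_uncovered hl hcov (x := (x % L).toNat)
      (mem_range.2 (by omega))
    refine ⟨_, mem_congruences.2 ⟨p, hp, rfl⟩, ?_⟩
    obtain ⟨hpL, hlt⟩ := hl p hp
    change x % (p.1 : ℤ) = (p.2 : ℤ) % (p.1 : ℤ)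
    rw [← Int.emod_emod_of_dvd x (Int.natCast_dvd_natCast.2 hpL), ← Int.toNat_of_nonneg h0,
      ← Int.natCast_mod, ← Int.natCast_mod, hx, Nat.mod_eq_of_lt hlt]
  · obtain ⟨p, hp, rfl⟩ := List.mem_map.1 hmem
    exact ⟨_, mem_congruences.2 ⟨p, hp, rfl⟩, rfl⟩
  · intro n hn
    obtain ⟨p, hp, rfl⟩ := List.mem_map.1 (IsModulus.mem_map_fst hn)
    exact hge p hp
  · apply Nat.dvd_antisymm
    · apply Finset.lcm_dvd
      intro p hp
      obtain ⟨q, hq, rfl⟩ := mem_congruences.1 hp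
      exact (hl q hq).1
    · conv_lhs => rw [← hlcm]
      apply foldr_lcm_dvd
      intro p hp
      exact dvd_lcm (f := Prod.fst) (mem_congruences.2 ⟨p, hp, rfl⟩)

/-- If N ≠ M, every modulus is at most N < M, so the congruence 0 modulo M can be added: its modulus
is new, it leaves the least modulus alone, and it raises the lcm to M. -/
theorem IsDistinctCoveringWith.exists_of_dvd {m N M : ℕ} {C : Finset (ℕ × ℤ)}
    (h : IsDistinctCoveringWith m N C) (hNM : N ∣ M) (hM : 0 < M) :
    ∃ C', IsDistinctCoveringWith m M C' := by
  classical
  by_cases hne : N = M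
  · exact ⟨C, hne ▸ h⟩
  have hN : 0 < N := Nat.pos_of_dvd_of_pos hNM hM
  have hlt : ∀ p ∈ C, p.1 < M := fun p hp =>
    (Nat.le_of_dvd hN (h.dvd hp)).trans_lt ((Nat.le_of_dvd hM hNM).lt_of_ne hne)
  obtain ⟨p₀, hp₀, hpm⟩ := h.2.1.1
  have hmM : m < M := hpm ▸ hlt p₀ hp₀
  refine ⟨insert (M, 0) C, ⟨?_, ?_, ?_⟩, ⟨⟨p₀, mem_insert_of_mem hp₀, hpm⟩, ?_⟩, ?_⟩
  · intro p hp
    rcases mem_insert.1 hp with rfl | hp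
    · exact (h.1.1 p₀ hp₀).trans (hlt p₀ hp₀)
    · exact h.1.1 p hp
  · intro p hp q hq hpq
    rcases mem_insert.1 hp with rfl | hp <;> rcases mem_insert.1 hq with rfl | hq
    · rfl
    · exact absurd hpq.symm (hlt q hq).ne
    · exact absurd hpq (hlt p hp).ne
    · exact h.1.2.1 p hp q hq hpq
  · intro x
    obtain ⟨p, hp, hx⟩ := h.1.2.2 x
    exact ⟨p, mem_insert_of_mem hp, hx⟩
  · rintro n ⟨p, hp, rfl⟩
    rcases mem_insert.1 hp with rfl | hp
    · exact hmM.le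
    · exact h.2.1.2 ⟨p, hp, rfl⟩
  · rw [lcm_insert, h.2.2]
    exact Nat.lcm_eq_left hNM

/-- The moduli and residues of a covering with least common multiple `1440`. -/
def covering1440 : List (ℕ × ℕ) := [
  (5, 0), (6, 0), (8, 1), (9, 1), (10, 1), (12, 8), (15, 2), (16, 5), (18, 4), (20, 3),
  (24, 2), (30, 9), (32, 6), (36, 16), (40, 19), (45, 7), (48, 14), (60, 27), (72, 34),
  (80, 13), (90, 67), (96, 86), (120, 119), (144, 142), (160, 109), (180, 79), (240, 237),
  (288, 214), (360, 319), (480, 29), (720, 349), (1440, 1309)]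

theorem isDistinctCoveringWith_covering1440 :
    IsDistinctCoveringWith 5 1440 (congruences covering1440) :=
  isDistinctCoveringWith_congruences (by norm_num) (by norm_num) (by decide +kernel)
    (by decide +kernel) (by decide +kernel) (by decide +kernel) (by decide +kernel)
    (by decide +kernel)

/-- The moduli and residues of a covering with least common multiple `2160`. -/
def covering2160 : List (ℕ × ℕ) := [
  (5, 0), (6, 0), (8, 1), (9, 1), (10, 6), (12, 3), (15, 2), (16, 5), (18, 4), (20, 8),
  (24, 11), (27, 7), (30, 14), (36, 31), (40, 23), (45, 11), (48, 45), (54, 16), (60, 38),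
  (72, 43), (80, 13), (90, 41), (108, 106), (120, 119), (135, 52), (144, 13), (216, 151),
  (240, 29), (270, 79), (360, 71), (432, 205), (540, 484), (720, 701), (1080, 511),
  (2160, 781)]

theorem isDistinctCoveringWith_covering2160 :
    IsDistinctCoveringWith 5 2160 (congruences covering2160) :=
  isDistinctCoveringWith_congruences (by norm_num) (by norm_num) (by decide +kernel)
    (by decide +kernel) (by decide +kernel) (by decide +kernel) (by decide +kernel)
    (by decide +kernel)

/-- The moduli and residues of a covering with least common multiple `3600`. -/
def covering3600 : List (ℕ × ℕ) := [
  (5, 0), (6, 0), (8, 1), (9, 1), (10, 1), (12, 8), (15, 2), (16, 2), (18, 4), (20, 3),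
  (24, 14), (30, 27), (36, 16), (40, 13), (45, 7), (48, 26), (50, 29), (60, 39), (72, 70),
  (75, 59), (80, 69), (90, 67), (120, 59), (144, 106), (150, 89), (180, 79), (200, 119),
  (225, 49), (240, 189), (360, 139), (400, 269), (450, 139), (600, 599), (720, 349),
  (1200, 749), (1800, 1759), (3600, 1309)]

theorem isDistinctCoveringWith_covering3600 :
    IsDistinctCoveringWith 5 3600 (congruences covering3600) :=
  isDistinctCoveringWith_congruences (by norm_num) (by norm_num) (by decide +kernel)
    (by decide +kernel) (by decide +kernel) (by decide +kernel) (by decide +kernel)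
    (by decide +kernel)

/-- The moduli and residues of a covering with least common multiple `5400`. -/
def covering5400 : List (ℕ × ℕ) := [
  (5, 0), (6, 0), (8, 1), (9, 1), (10, 1), (12, 8), (15, 2), (18, 4), (20, 3), (24, 2),
  (25, 4), (27, 7), (30, 9), (36, 2), (40, 13), (45, 7), (50, 9), (54, 16), (60, 27),
  (72, 14), (75, 14), (90, 67), (100, 19), (108, 52), (120, 117), (135, 79), (150, 149),
  (180, 26), (200, 69), (216, 106), (225, 49), (270, 259), (300, 139), (360, 278), (450, 44),
  (540, 106), (600, 134), (900, 589), (1080, 1078), (1800, 1574)]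

theorem isDistinctCoveringWith_covering5400 :
    IsDistinctCoveringWith 5 5400 (congruences covering5400) :=
  isDistinctCoveringWith_congruences (by norm_num) (by norm_num) (by decide +kernel)
    (by decide +kernel) (by decide +kernel) (by decide +kernel) (by decide +kernel)
    (by decide +kernel)

/-! ### The classification of types -/

theorem exponent_bounds_of_covering (C : Finset (ℕ × ℤ)) (a b c : ℕ) (hc : 1 ≤ c) (hcb : c ≤ b)
    (hba : b ≤ a) (h : IsDistinctCoveringWith 5 (2 ^ a * 3 ^ b * 5 ^ c) C) :
    2 ≤ b ∧ (a = 3 → 3 ≤ b ∧ 2 ≤ c) ∧ (a = 4 → b = 2 → 2 ≤ c) := by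
  have hdvd : ∀ {i j k : ℕ}, a ≤ i → b ≤ j → c ≤ k →
      2 ^ a * 3 ^ b * 5 ^ c ∣ 2 ^ i * 3 ^ j * 5 ^ k := fun h1 h2 h3 =>
    Nat.mul_dvd_mul (Nat.mul_dvd_mul (pow_dvd_pow _ h1) (pow_dvd_pow _ h2)) (pow_dvd_pow _ h3)
  refine ⟨?_, ?_, ?_⟩
  · by_contra hb
    obtain rfl : b = 1 := by omega
    obtain rfl : c = 1 := by omega
    exact not_covering_two_pow_mul_fifteen (a := a) (by simpa [mul_assoc] using h)
  · intro ha
    constructor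
    · by_contra hb
      exact not_covering_of_dvd_1800 (hdvd (i := 3) (j := 2) (k := 2) (by omega) (by omega)
        (by omega)) h
    · by_contra hc2
      exact not_covering_of_dvd_1080 (hdvd (i := 3) (j := 3) (k := 1) (by omega) (by omega)
        (by omega)) h
  · intro ha hb
    by_contra hc2
    exact not_covering_of_dvd_720 (hdvd (i := 4) (j := 2) (k := 1) (by omega) (by omega)
      (by omega)) h

theorem exists_covering_of_le {i j k a b c N : ℕ} {C : Finset (ℕ × ℤ)}
    (h : IsDistinctCoveringWith 5 N C) (hN : N = 2 ^ i * 3 ^ j * 5 ^ k) (hi : i ≤ a) (hj : j ≤ b)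
    (hk : k ≤ c) : ∃ C', IsDistinctCoveringWith 5 (2 ^ a * 3 ^ b * 5 ^ c) C' := by
  subst hN
  exact h.exists_of_dvd (Nat.mul_dvd_mul (Nat.mul_dvd_mul (pow_dvd_pow _ hi) (pow_dvd_pow _ hj))
    (pow_dvd_pow _ hk)) (by positivity)

end

theorem theorem1p7 :
    -- necessary conditions
    (∀ (C : Finset (ℕ × ℤ)) (a b c : ℕ), 1 ≤ c → c ≤ b → b ≤ a →
      IsDistinctCoveringWith 5 (2 ^ a * 3 ^ b * 5 ^ c) C →
        2 ≤ b ∧ (a = 3 → 3 ≤ b ∧ 2 ≤ c) ∧ (a = 4 → b = 2 → 2 ≤ c)) ∧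
    -- existence for (3, 3, 2)
    (∃ C : Finset (ℕ × ℤ), IsDistinctCoveringWith 5 (2 ^ 3 * 3 ^ 3 * 5 ^ 2) C ∧
      ∀ n : ℕ, IsModulus C n → ¬ 675 ∣ n) ∧
    -- existence for (4, 2, 2)
    (∃ C : Finset (ℕ × ℤ), IsDistinctCoveringWith 5 (2 ^ 4 * 3 ^ 2 * 5 ^ 2) C ∧
      ¬ IsModulus C 25 ∧ ¬ IsModulus C 100 ∧ ¬ IsModulus C 300 ∧ ¬ IsModulus C 900) ∧
    -- existence for (4, 3, 1)
    (∃ C : Finset (ℕ × ℤ), IsDistinctCoveringWith 5 (2 ^ 4 * 3 ^ 3 * 5 ^ 1) C ∧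
      ¬ IsModulus C 180) ∧
    -- existence for (5, 2, 1)
    (∃ C : Finset (ℕ × ℤ), IsDistinctCoveringWith 5 (2 ^ 5 * 3 ^ 2 * 5 ^ 1) C) ∧
    -- the resulting complete description
    (∀ a b c : ℕ, 1 ≤ c → c ≤ b → b ≤ a →
      ((∃ C : Finset (ℕ × ℤ), IsDistinctCoveringWith 5 (2 ^ a * 3 ^ b * 5 ^ c) C) ↔
        (a = 3 ∧ b = 3 ∧ 2 ≤ c) ∨ (a = 4 ∧ 2 ≤ b ∧ (3 ≤ b ∨ 2 ≤ c)) ∨ (5 ≤ a ∧ 2 ≤ b))) := by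
  refine ⟨exponent_bounds_of_covering,
    ⟨_, isDistinctCoveringWith_covering5400, fun n hn =>
      (show ∀ n ∈ covering5400.map Prod.fst, ¬ 675 ∣ n by decide +kernel) n hn.mem_map_fst⟩,
    ⟨_, isDistinctCoveringWith_covering3600,
      fun h => absurd h.mem_map_fst (by decide +kernel),
      fun h => absurd h.mem_map_fst (by decide +kernel),
      fun h => absurd h.mem_map_fst (by decide +kernel),
      fun h => absurd h.mem_map_fst (by decide +kernel)⟩,
    ⟨_, isDistinctCoveringWith_covering2160, fun h => absurd h.mem_map_fst (by decide +kernel)⟩,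
    ⟨_, isDistinctCoveringWith_covering1440⟩, ?_⟩
  intro a b c hc hcb hba
  constructor
  · rintro ⟨C, h⟩
    obtain ⟨h1, h2, h3⟩ := exponent_bounds_of_covering C a b c hc hcb hba h
    -- The bounds from the necessary conditions leave a = 2 open; then b and c are at most 2 as
    -- well, and the lcm divides 1800.
    have ha : a ≠ 2 := by
      intro ha
      exact not_covering_of_dvd_1800 (Nat.mul_dvd_mul (Nat.mul_dvd_mul
        (pow_dvd_pow 2 (show a ≤ 3 by omega)) (pow_dvd_pow 3 (show b ≤ 2 by omega)))
        (pow_dvd_pow 5 (show c ≤ 2 by omega))) h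
    omega
  · rintro (⟨ha, hb, hc⟩ | ⟨ha, hb, hb3 | hc2⟩ | ⟨ha, hb⟩)
    · exact exists_covering_of_le isDistinctCoveringWith_covering5400 (i := 3) (j := 3) (k := 2)
        (by norm_num) (by omega) (by omega) hc
    · exact exists_covering_of_le isDistinctCoveringWith_covering2160 (i := 4) (j := 3) (k := 1)
        (by norm_num) (by omega) hb3 hc
    · exact exists_covering_of_le isDistinctCoveringWith_covering3600 (i := 4) (j := 2) (k := 2)
        (by norm_num) (by omega) hb hc2
    · exact exists_covering_of_le isDistinctCoveringWith_covering1440 (i := 5) (j := 2) (k := 1)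
        (by norm_num) ha hb hc
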